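/- Consider an $M|M|\infty$ queue that is empty at time $0$: customers arrive according to a Poisson process of rate $\lambda>0$ (the interarrival times, counted from time $0$, are i.i.d. exponential with rate $\lambda$); every customer is served from the moment of arrival; the service times are i.i.d. exponential with mean $\alpha>0$ and independent of the arrivals. Let $\rho=\lambda\alpha$ and assume $\rho\neq 1$. Let $I$ be the length of the idle period that starts at time $0$ (the first time at which the system is not empty), let $B$ be the length of the busy period that follows it (the time from $I$ until the system is next empty), and let $Z=I+B$ be the length of the busy cycle. Then for all $t\ge 0$ $$e^{-\rho}\left(1-\frac{\rho e^{-t/\alpha}-e^{-\lambda t}}{\rho-1}\right)\le P(Z\le t)\le 1-\frac{\rho e^{-t/\alpha}-e^{-\lambda t}}{\rho-1}.$$ -/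

import Mathlib

open MeasureTheory ProbabilityTheory
open scoped ENNReal NNReal

namespace InfiniteServerQueue

variable {Ω : Type*}

/-- The `M|G|∞` queue that is empty at time `0`: the interarrival times `τ 0, τ 1, …` of the
customers are exponential with rate `lam` (that is, the arrivals form a Poisson process of rate
`lam`), the service times `σ 0, σ 1, …` have law `G`, and all these variables are mutually
independent. Every customer is served from the moment of arrival. -/
structure IsMGInfQueue [MeasurableSpace Ω] (P : Measure Ω) (lam : ℝ) (G : Measure ℝ)
    (τ σ : ℕ → Ω → ℝ) : Prop where
  interarrival_law : ∀ n, HasLaw (τ n) (expMeasure lam) P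
  service_law : ∀ n, HasLaw (σ n) G P
  indep : iIndepFun (Sum.elim τ σ) P

/-- The `M|M|∞` queue with arrival rate `lam` and exponential service times of mean `α`. -/
def IsMMInfQueue [MeasurableSpace Ω] (P : Measure Ω) (lam α : ℝ) (τ σ : ℕ → Ω → ℝ) : Prop :=
  IsMGInfQueue P lam (expMeasure (1 / α)) τ σ

/-- The arrival time of customer `n` (customers are numbered from `0`). -/
def arrival (τ : ℕ → Ω → ℝ) (n : ℕ) (ω : Ω) : ℝ := ∑ i ∈ Finset.range (n + 1), τ i ω

/-- The departure time of customer `n`: service starts at once and lasts `σ n`. -/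
def departure (τ σ : ℕ → Ω → ℝ) (n : ℕ) (ω : Ω) : ℝ := arrival τ n ω + σ n ω

/-- The number of customers in the system at time `t`. -/
noncomputable def numberInSystem (τ σ : ℕ → Ω → ℝ) (t : ℝ) (ω : Ω) : ℕ∞ :=
  {n : ℕ | arrival τ n ω ≤ t ∧ t < departure τ σ n ω}.encard

/-- The length `I` of the idle period that starts at time `0`: the first time at which the system
is not empty (`∞` if there is none). -/
noncomputable def idlePeriod (τ σ : ℕ → Ω → ℝ) (ω : Ω) : ℝ≥0∞ :=
  ⨅ (t : ℝ≥0) (_ : numberInSystem τ σ t ω ≠ 0), (t : ℝ≥0∞)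

/-- The length `B` of the busy period that follows the idle period: the smallest `u ≥ 0` such that
the system is empty at time `I + u` (`∞` if there is none). -/
noncomputable def busyPeriod (τ σ : ℕ → Ω → ℝ) (ω : Ω) : ℝ≥0∞ :=
  ⨅ (u : ℝ≥0) (_ : ∃ t : ℝ≥0, (t : ℝ≥0∞) = idlePeriod τ σ ω + u ∧ numberInSystem τ σ t ω = 0),
    (u : ℝ≥0∞)

/-- The length `Z = I + B` of the busy cycle. -/
noncomputable def busyCycle (τ σ : ℕ → Ω → ℝ) (ω : Ω) : ℝ≥0∞ :=
  idlePeriod τ σ ω + busyPeriod τ σ ω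

end InfiniteServerQueue

open Set

namespace InfiniteServerQueue

/-! ### Exponential laws: tilting and sums -/

section Exponential

/-! Only customers 0 and 1 matter. Almost surely `I = τ 0` and customer 0 keeps the system busy for
`σ 0`, so `Z ≥ τ 0 + σ 0`; the law of this sum gives the upper bound (`add_le_of_busyCycle_le`,
`prod_expMeasure_add_le`). If moreover `σ 0 < τ 1`, customer 0 leaves an empty system and `Z ≤ τ 0 +
σ 0` (`busyCycle_le_of_add_le`). Given `σ 0 = y`, this has probability `exp (-lam * y)`. Weighting
the law of `σ 0` by this factor gives `1 / (1 + ρ) ≥ exp (-ρ)` times an exponential law of larger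
rate, whose distribution function is larger; hence the lower bound
(`exp_neg_div_mul_prod_expMeasure_le`). -/

lemma expMeasure_Iic {r : ℝ} (hr : 0 < r) (x : ℝ) :
    expMeasure r (Iic x) = ENNReal.ofReal (if 0 ≤ x then 1 - Real.exp (-(r * x)) else 0) := by
  rw [expMeasure, gammaMeasure, withDensity_apply _ measurableSet_Iic]
  exact lintegral_exponentialPDF_eq_antiDeriv hr x

lemma expMeasure_Ioi {r x : ℝ} (hr : 0 < r) (hx : 0 ≤ x) :
    expMeasure r (Ioi x) = ENNReal.ofReal (Real.exp (-(r * x))) := by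
  have := isProbabilityMeasure_expMeasure hr
  have h1 : Real.exp (-(r * x)) ≤ 1 := Real.exp_le_one_iff.2 (by nlinarith)
  rw [← compl_Iic, prob_compl_eq_one_sub measurableSet_Iic, expMeasure_Iic hr, if_pos hx,
    ← ENNReal.ofReal_one, ← ENNReal.ofReal_sub _ (by linarith)]
  congr 1
  ring

lemma ae_pos_expMeasure {r : ℝ} (hr : 0 < r) : ∀ᵐ x ∂expMeasure r, 0 < x := by
  have h : {x : ℝ | ¬ 0 < x} = Iic 0 := by ext x; simp
  rw [ae_iff, h, expMeasure_Iic hr]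
  simp

lemma measurable_exponentialPDF (r : ℝ) : Measurable (exponentialPDF r) :=
  (measurable_exponentialPDFReal r).ennreal_ofReal

lemma lintegral_expMeasure (r : ℝ) {f : ℝ → ℝ≥0∞} (hf : Measurable f) :
    ∫⁻ x, f x ∂expMeasure r = ∫⁻ x, exponentialPDF r x * f x :=
  lintegral_withDensity_eq_lintegral_mul _ (measurable_exponentialPDF r) hf

/-- Exponential tilting of an exponential law is, up to a constant, an exponential law. -/
lemma setLIntegral_Iic_exp_neg_expMeasure {a b : ℝ} (ha : 0 < a) (hb : 0 < b) (u : ℝ) :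
    ∫⁻ y in Iic u, ENNReal.ofReal (Real.exp (-(a * y))) ∂expMeasure b =
      ENNReal.ofReal (b / (a + b)) * expMeasure (a + b) (Iic u) := by
  have hexp : Measurable fun y : ℝ ↦ ENNReal.ofReal (Real.exp (-(a * y))) := by fun_prop
  rw [← lintegral_indicator measurableSet_Iic,
    lintegral_expMeasure b (hexp.indicator measurableSet_Iic),
    ← lintegral_indicator_one measurableSet_Iic,
    lintegral_expMeasure (a + b) (measurable_one.indicator measurableSet_Iic),
    ← lintegral_const_mul' _ _ ENNReal.ofReal_ne_top]
  refine lintegral_congr fun y ↦ ?_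
  by_cases hy : y ∈ Iic u
  swap
  · simp [hy]
  rcases lt_or_ge y 0 with h0 | h0
  · simp [exponentialPDF_of_neg h0]
  · rw [indicator_of_mem hy, indicator_of_mem hy, Pi.one_apply, mul_one,
      exponentialPDF_of_nonneg h0, exponentialPDF_of_nonneg h0,
      ← ENNReal.ofReal_mul (by positivity), ← ENNReal.ofReal_mul (by positivity)]
    congr 1
    rw [mul_assoc, ← Real.exp_add, ← mul_assoc, div_mul_cancel₀ _ (by positivity)]
    congr 2
    ring

/-- After tilting, the two factors compare separately: `1 + a / b ≤ exp (a / b)`, and raising the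
rate from `b` to `a + b` increases the distribution function. -/
lemma exp_neg_div_mul_expMeasure_Iic_le {a b : ℝ} (ha : 0 < a) (hb : 0 < b) (u : ℝ) :
    ENNReal.ofReal (Real.exp (-(a / b))) * expMeasure b (Iic u) ≤
      ∫⁻ y in Iic u, ENNReal.ofReal (Real.exp (-(a * y))) ∂expMeasure b := by
  rw [setLIntegral_Iic_exp_neg_expMeasure ha hb, expMeasure_Iic hb, expMeasure_Iic (by positivity)]
  gcongr
  · have h := Real.add_one_le_exp (a / b)
    have h' : b / (a + b) = (a / b + 1)⁻¹ := by field_simp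
    rw [h', Real.exp_neg]
    gcongr
  · split_ifs with hu
    · gcongr
      linarith
    · rfl

lemma prod_expMeasure_add_le_eq_lintegral {a b : ℝ} (hb : 0 < b) (t : ℝ) :
    ((expMeasure a).prod (expMeasure b)) {p | p.1 + p.2 ≤ t} =
      ∫⁻ x, expMeasure b (Iic (t - x)) ∂expMeasure a := by
  have := isProbabilityMeasure_expMeasure hb
  rw [Measure.prod_apply (measurableSet_le (by fun_prop) (by fun_prop))]
  refine lintegral_congr fun x ↦ congrArg _ ?_
  ext y
  simp [le_sub_iff_add_le']

lemma integral_hypoexponential {a b : ℝ} (hab : a ≠ b) (t : ℝ) :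
    ∫ x in (0 : ℝ)..t, a * Real.exp (-(a * x)) * (1 - Real.exp (-(b * (t - x)))) =
      1 - (a * Real.exp (-(b * t)) - b * Real.exp (-(a * t))) / (a - b) := by
  have hne : a - b ≠ 0 := sub_ne_zero.2 hab
  -- The exponent `-(a * x) - b * (t - x)` has slope `-(a - b)`, whence the factor `a / (a - b)`.
  have hderiv (x : ℝ) : HasDerivAt
      (fun x ↦ -Real.exp (-(a * x)) + a / (a - b) * Real.exp (-(a * x) - b * (t - x)))
      (a * Real.exp (-(a * x)) * (1 - Real.exp (-(b * (t - x))))) x := by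
    have h1 : HasDerivAt (fun x ↦ -(a * x)) (-a) x := by
      convert! (hasDerivAt_id x).const_mul (-a) using 1 <;> simp
    have h2 : HasDerivAt (fun x ↦ b * (t - x)) (-b) x := by
      simpa using ((hasDerivAt_id x).const_sub t).const_mul b
    refine (h1.exp.neg.add ((h1.sub h2).exp.const_mul (a / (a - b)))).congr_deriv ?_
    rw [Pi.sub_apply, sub_eq_add_neg (-(a * x)), Real.exp_add]
    field_simp
    ring
  rw [intervalIntegral.integral_eq_sub_of_hasDerivAt (fun x _ ↦ hderiv x)
    (Continuous.intervalIntegrable (by fun_prop) _ _)]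
  simp only [sub_self, mul_zero, sub_zero, neg_zero, zero_sub, Real.exp_zero]
  field_simp
  ring

/-- The distribution function of the sum of two independent exponential variables with different
rates. -/
lemma prod_expMeasure_add_le {a b t : ℝ} (ha : 0 < a) (hb : 0 < b) (hab : a ≠ b) (ht : 0 ≤ t) :
    ((expMeasure a).prod (expMeasure b)).real {p | p.1 + p.2 ≤ t} =
      1 - (a * Real.exp (-(b * t)) - b * Real.exp (-(a * t))) / (a - b) := by
  have hmeas : Measurable fun x ↦ expMeasure b (Iic (t - x)) := by
    have (x : ℝ) := expMeasure_Iic hb (t - x)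
    simp_rw [this]
    refine (Measurable.ite (measurableSet_le (by fun_prop) (by fun_prop)) ?_ ?_).ennreal_ofReal <;>
      fun_prop
  have hnonneg : ∀ x ∈ Icc 0 t, 0 ≤ a * Real.exp (-(a * x)) * (1 - Real.exp (-(b * (t - x)))) := by
    intro x hx
    have : Real.exp (-(b * (t - x))) ≤ 1 := Real.exp_le_one_iff.2 (by nlinarith [hx.2])
    have : 0 ≤ 1 - Real.exp (-(b * (t - x))) := by linarith
    positivity
  -- The density vanishes for `x < 0`, the distribution function for `x > t`.
  have hpt (x : ℝ) : exponentialPDF a x * expMeasure b (Iic (t - x)) = (Icc 0 t).indicator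
      (fun x ↦ ENNReal.ofReal (a * Real.exp (-(a * x)) * (1 - Real.exp (-(b * (t - x)))))) x := by
    rw [expMeasure_Iic hb, exponentialPDF_eq, indicator_apply]
    by_cases h0 : 0 ≤ x <;> by_cases h1 : x ≤ t
    · simp only [h0, h1, sub_nonneg, if_true, mem_Icc, and_self]
      rw [← ENNReal.ofReal_mul (by positivity)]
    all_goals simp [h0, h1]
  rw [measureReal_def, prod_expMeasure_add_le_eq_lintegral hb, lintegral_expMeasure a hmeas,
    lintegral_congr hpt, lintegral_indicator measurableSet_Icc,
    ← ofReal_integral_eq_lintegral_ofReal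
      (Continuous.integrableOn_Icc (by fun_prop))
      ((ae_restrict_iff' measurableSet_Icc).2 (.of_forall hnonneg)),
    ENNReal.toReal_ofReal (setIntegral_nonneg measurableSet_Icc hnonneg),
    integral_Icc_eq_integral_Ioc, ← intervalIntegral.integral_of_le ht,
    integral_hypoexponential hab]

lemma measurableSet_add_le_and_lt (t : ℝ) :
    MeasurableSet {q : (ℝ × ℝ) × ℝ | q.1.1 + q.1.2 ≤ t ∧ q.1.2 < q.2} := by
  have h1 : MeasurableSet {q : (ℝ × ℝ) × ℝ | q.1.1 + q.1.2 ≤ t} :=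
    measurableSet_le (by fun_prop) (by fun_prop)
  have h2 : MeasurableSet {q : (ℝ × ℝ) × ℝ | q.1.2 < q.2} :=
    measurableSet_lt (by fun_prop) (by fun_prop)
  exact h1.inter h2

lemma exp_neg_div_mul_prod_expMeasure_le {a b : ℝ} (ha : 0 < a) (hb : 0 < b) (t : ℝ) :
    ENNReal.ofReal (Real.exp (-(a / b))) *
        ((expMeasure a).prod (expMeasure b)) {p | p.1 + p.2 ≤ t} ≤
      (((expMeasure a).prod (expMeasure b)).prod (expMeasure a))
        {q | q.1.1 + q.1.2 ≤ t ∧ q.1.2 < q.2} := by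
  have := isProbabilityMeasure_expMeasure ha
  have := isProbabilityMeasure_expMeasure hb
  have hs := measurableSet_add_le_and_lt t
  rw [Measure.prod_apply hs, lintegral_prod _ (measurable_measure_prodMk_left hs).aemeasurable,
    prod_expMeasure_add_le_eq_lintegral hb, ← lintegral_const_mul' _ _ ENNReal.ofReal_ne_top]
  refine lintegral_mono fun x ↦ (exp_neg_div_mul_expMeasure_Iic_le ha hb (t - x)).trans ?_
  rw [← lintegral_indicator measurableSet_Iic]
  -- The tail at `y` equals `exp (-(a * y))` only for `y ≥ 0`, so negative `y` are discarded as a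
  -- null set.
  refine lintegral_mono_ae ?_
  filter_upwards [ae_pos_expMeasure hb] with y hy
  by_cases hyt : y ∈ Iic (t - x)
  swap
  · simp [hyt]
  rw [indicator_of_mem hyt, ← expMeasure_Ioi ha hy.le]
  refine measure_mono fun z hz ↦ ⟨?_, hz⟩
  have : y ≤ t - x := hyt
  change x + y ≤ t
  linarith

end Exponential

/-! ### Pathwise bounds on the busy cycle -/

section SamplePath

variable {Ω : Type*} {τ σ : ℕ → Ω → ℝ} {ω : Ω}

lemma monotone_arrival (hτ : ∀ n, 0 < τ n ω) : Monotone fun n ↦ arrival τ n ω :=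
  monotone_nat_of_le_succ fun n ↦ by
    simp only [arrival]
    rw [Finset.sum_range_succ _ (n + 1)]
    linarith [hτ (n + 1)]

lemma arrival_zero : arrival τ 0 ω = τ 0 ω := by simp [arrival]

lemma arrival_one : arrival τ 1 ω = τ 0 ω + τ 1 ω := by simp [arrival, Finset.sum_range_succ]

lemma numberInSystem_eq_zero_iff {t : ℝ} :
    numberInSystem τ σ t ω = 0 ↔ ∀ n, arrival τ n ω ≤ t → departure τ σ n ω ≤ t := by
  simp [numberInSystem, Set.eq_empty_iff_forall_notMem]

lemma numberInSystem_ne_zero_of_first_in_service {t : ℝ} (h0 : τ 0 ω ≤ t)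
    (h1 : t < τ 0 ω + σ 0 ω) : numberInSystem τ σ t ω ≠ 0 := by
  rw [Ne, numberInSystem_eq_zero_iff]
  intro h
  have := h 0 (by rwa [arrival_zero])
  rw [departure, arrival_zero] at this
  linarith

lemma idlePeriod_eq (hτ : ∀ n, 0 < τ n ω) (hσ : 0 < σ 0 ω) :
    idlePeriod τ σ ω = ENNReal.ofReal (τ 0 ω) := by
  apply le_antisymm
  -- The infimum is attained: `0 < σ 0 ω` puts customer 0 in the system at its arrival instant.
  · refine iInf₂_le (τ 0 ω).toNNReal ?_
    rw [Real.coe_toNNReal _ (hτ 0).le]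
    exact numberInSystem_ne_zero_of_first_in_service le_rfl (by linarith)
  · refine le_iInf₂ fun t ht ↦ ?_
    rw [← ENNReal.ofReal_coe_nnreal]
    apply ENNReal.ofReal_le_ofReal
    by_contra! hlt
    refine ht (numberInSystem_eq_zero_iff.2 fun n hn ↦ absurd hn (not_le.2 ?_))
    have := monotone_arrival hτ (Nat.zero_le n)
    simp only [arrival_zero] at this
    linarith

lemma ofReal_le_busyPeriod (hτ : ∀ n, 0 < τ n ω) (hσ : 0 < σ 0 ω) :
    ENNReal.ofReal (σ 0 ω) ≤ busyPeriod τ σ ω := by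
  refine le_iInf₂ fun u ⟨t, htu, ht⟩ ↦ ?_
  rw [idlePeriod_eq hτ hσ, ← ENNReal.ofReal_coe_nnreal, ← ENNReal.ofReal_coe_nnreal,
    ← ENNReal.ofReal_add (hτ 0).le u.coe_nonneg,
    ENNReal.ofReal_eq_ofReal_iff t.coe_nonneg (add_nonneg (hτ 0).le u.coe_nonneg)] at htu
  rw [← ENNReal.ofReal_coe_nnreal]
  apply ENNReal.ofReal_le_ofReal
  by_contra! hlt
  exact numberInSystem_ne_zero_of_first_in_service
    (by rw [htu]; exact le_add_of_nonneg_right u.coe_nonneg) (by rw [htu]; linarith) ht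

lemma busyPeriod_le_of_lt (hτ : ∀ n, 0 < τ n ω) (hσ : 0 < σ 0 ω) (h : σ 0 ω < τ 1 ω) :
    busyPeriod τ σ ω ≤ ENNReal.ofReal (σ 0 ω) := by
  have hadd : 0 ≤ τ 0 ω + σ 0 ω := by linarith [hτ 0]
  refine iInf₂_le (σ 0 ω).toNNReal ⟨(τ 0 ω + σ 0 ω).toNNReal, ?_, ?_⟩
  · rw [idlePeriod_eq hτ hσ]
    exact ENNReal.ofReal_add (hτ 0).le hσ.le
  · rw [Real.coe_toNNReal _ hadd, numberInSystem_eq_zero_iff]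
    rintro (_ | n) hn
    -- A customer no longer counts at its own departure instant; later customers have not yet
    -- arrived by then.
    · rw [departure, arrival_zero]
    · have := monotone_arrival hτ (Nat.le_add_left 1 n)
      simp only [arrival_one] at this
      linarith

lemma add_le_of_busyCycle_le {t : ℝ} (ht : 0 ≤ t) (hτ : ∀ n, 0 < τ n ω) (hσ : 0 < σ 0 ω)
    (h : busyCycle τ σ ω ≤ ENNReal.ofReal t) : τ 0 ω + σ 0 ω ≤ t := by
  rw [← ENNReal.ofReal_le_ofReal_iff ht, ENNReal.ofReal_add (hτ 0).le hσ.le,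
    ← idlePeriod_eq hτ hσ]
  exact (add_le_add_right (ofReal_le_busyPeriod hτ hσ) _).trans h

lemma busyCycle_le_of_add_le {t : ℝ} (hτ : ∀ n, 0 < τ n ω) (hσ : 0 < σ 0 ω)
    (h : τ 0 ω + σ 0 ω ≤ t) (hlt : σ 0 ω < τ 1 ω) :
    busyCycle τ σ ω ≤ ENNReal.ofReal t := by
  refine le_trans ?_ (ENNReal.ofReal_le_ofReal h)
  rw [busyCycle, idlePeriod_eq hτ hσ, ENNReal.ofReal_add (hτ 0).le hσ.le]
  gcongr
  exact busyPeriod_le_of_lt hτ hσ hlt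

end SamplePath

/-! ### Joint laws of the first variables -/

section Law

variable {Ω : Type*} [MeasurableSpace Ω] {P : Measure Ω}
  {lam α : ℝ} {G : Measure ℝ} {τ σ : ℕ → Ω → ℝ}

lemma IsMMInfQueue.ae_pos (hQ : IsMMInfQueue P lam α τ σ) (hlam : 0 < lam) (hα : 0 < α) :
    ∀ᵐ ω ∂P, (∀ n, 0 < τ n ω) ∧ 0 < σ 0 ω := by
  have hpos {X : Ω → ℝ} {r : ℝ} (hr : 0 < r) (hX : HasLaw X (expMeasure r) P) :
      ∀ᵐ ω ∂P, 0 < X ω :=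
    (hX.ae_iff (p := fun x ↦ 0 < x) (measurableSet_setOfPred.1 measurableSet_Ioi)).2
      (ae_pos_expMeasure hr)
  exact (ae_all_iff.2 fun n ↦ hpos hlam (hQ.interarrival_law n)).and
    (hpos (one_div_pos.2 hα) (hQ.service_law 0))

variable [IsProbabilityMeasure P]

lemma IsMGInfQueue.hasLaw_first (hQ : IsMGInfQueue P lam G τ σ) [SFinite G]
    (hlam : 0 < lam) :
    HasLaw (fun ω ↦ (τ 0 ω, σ 0 ω)) ((expMeasure lam).prod G) P := by
  have := isProbabilityMeasure_expMeasure hlam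
  have hind : IndepFun (τ 0) (σ 0) P :=
    hQ.indep.indepFun (i := Sum.inl 0) (j := Sum.inr 0) (by simp)
  exact (indepFun_iff_hasLaw_prodMk_prod (hQ.interarrival_law 0) (hQ.service_law 0)).1 hind

lemma IsMGInfQueue.hasLaw_first_next (hQ : IsMGInfQueue P lam G τ σ) [SFinite G]
    (hlam : 0 < lam) :
    HasLaw (fun ω ↦ ((τ 0 ω, σ 0 ω), τ 1 ω))
      (((expMeasure lam).prod G).prod (expMeasure lam)) P := by
  have := isProbabilityMeasure_expMeasure hlam
  have hmeas : ∀ i, AEMeasurable (Sum.elim τ σ i) P := by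
    rintro (i | i)
    · exact (hQ.interarrival_law i).aemeasurable
    · exact (hQ.service_law i).aemeasurable
  have hind : IndepFun (fun ω ↦ (τ 0 ω, σ 0 ω)) (τ 1) P :=
    hQ.indep.indepFun_prodMk₀ hmeas (Sum.inl 0) (Sum.inr 0) (Sum.inl 1) (by simp) (by simp)
  exact (indepFun_iff_hasLaw_prodMk_prod (hQ.hasLaw_first hlam) (hQ.interarrival_law 1)).1 hind

end Law

end InfiniteServerQueue

open InfiniteServerQueue in
theorem mainTheorem4 {Ω : Type*} [MeasurableSpace Ω] (P : Measure Ω) [IsProbabilityMeasure P]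
    (lam α ρ : ℝ) (hlam : 0 < lam) (hα : 0 < α) (hρ : ρ = lam * α) (hρ1 : ρ ≠ 1)
    (τ σ : ℕ → Ω → ℝ) (hQ : InfiniteServerQueue.IsMMInfQueue P lam α τ σ)
    (t : ℝ) (ht : 0 ≤ t) :
    Real.exp (-ρ) * (1 - (ρ * Real.exp (-t / α) - Real.exp (-lam * t)) / (ρ - 1)) ≤
        P.real {ω | InfiniteServerQueue.busyCycle τ σ ω ≤ ENNReal.ofReal t} ∧
      P.real {ω | InfiniteServerQueue.busyCycle τ σ ω ≤ ENNReal.ofReal t} ≤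
        1 - (ρ * Real.exp (-t / α) - Real.exp (-lam * t)) / (ρ - 1) := by
  have hα' : 0 < 1 / α := one_div_pos.2 hα
  have := isProbabilityMeasure_expMeasure hlam
  have := isProbabilityMeasure_expMeasure hα'
  have hne : lam ≠ 1 / α := fun h ↦ hρ1 (by rw [hρ, h, one_div_mul_cancel hα.ne'])
  have hcdf : 1 - (ρ * Real.exp (-t / α) - Real.exp (-lam * t)) / (ρ - 1) =
      ((expMeasure lam).prod (expMeasure (1 / α))).real {p | p.1 + p.2 ≤ t} := by
    rw [prod_expMeasure_add_le hlam hα' hne ht]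
    have h1 : ρ - 1 ≠ 0 := sub_ne_zero.2 hρ1
    have h2 : lam - 1 / α = (ρ - 1) / α := by rw [hρ]; field_simp
    rw [h2, show -t / α = -(1 / α * t) by ring, neg_mul, hρ]
    rw [hρ] at h1
    field_simp
  rw [hcdf]
  constructor
  · have hle : ENNReal.ofReal (Real.exp (-ρ)) *
        ((expMeasure lam).prod (expMeasure (1 / α))) {p | p.1 + p.2 ≤ t} ≤
        P {ω | busyCycle τ σ ω ≤ ENNReal.ofReal t} := by
      have h := exp_neg_div_mul_prod_expMeasure_le hlam hα' t
      rw [one_div, div_inv_eq_mul, ← hρ, ← one_div, ← (hQ.hasLaw_first_next hlam).measure_eq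
        (p := fun q ↦ q.1.1 + q.1.2 ≤ t ∧ q.1.2 < q.2)
        (measurableSet_add_le_and_lt t)] at h
      -- Inclusion up to a null set suffices, so measurability of `busyCycle` is not needed.
      refine h.trans (measure_mono_ae ?_)
      filter_upwards [hQ.ae_pos hlam hα] with ω hω hcycle
      exact busyCycle_le_of_add_le hω.1 hω.2 hcycle.1 hcycle.2
    have h := ENNReal.toReal_mono (measure_ne_top P _) hle
    rwa [ENNReal.toReal_mul, ENNReal.toReal_ofReal (Real.exp_pos _).le] at h
  · rw [← (hQ.hasLaw_first hlam).measureReal_eq (p := fun p ↦ p.1 + p.2 ≤ t)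
      (measurableSet_le (by fun_prop) (by fun_prop))]
    refine ENNReal.toReal_mono (measure_ne_top P _) (measure_mono_ae ?_)
    filter_upwards [hQ.ae_pos hlam hα] with ω hω hcycle
    exact add_le_of_busyCycle_le ht hω.1 hω.2 hcycle
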